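/- Let $n\ge 0$, $N=2^n$, let $c:\{0,1\}^n\to[0,1]$, and put $\gamma=\gamma(c)=\frac1N\sum_x c(x)^2$, $H_c=\operatorname{diag}(c(x)/2)_x$, $|+\rangle=\big(\tfrac{|0\rangle+|1\rangle}{\sqrt2}\big)^{\otimes n}$ and, when $\gamma>0$, $|\psi_c\rangle=\frac1{\sqrt{N\gamma}}\sum_x c(x)|x\rangle$ (when $\gamma=0$, set $|\psi_c\rangle=0$). A unitary $C$ on $a+n$ qubits ($a$ control qubits and $n$ system qubits) is an exact block-encoding of $H_c$ if $(\langle 0|^{\otimes a}\otimes\mathbb 1)\,C\,(|0\rangle^{\otimes a}\otimes\mathbb 1)=H_c$. (1) $H_c|+\rangle=\frac{\sqrt\gamma}{2}|\psi_c\rangle$. Consequently, if $C$ is an exact block-encoding of $H_c$, then $C\,|0\rangle^{\otimes a}|+\rangle=\frac{\sqrt\gamma}{2}|0\rangle^{\otimes a}|\psi_c\rangle+|\Phi\rangle$ for some $|\Phi\rangle$ with $(\langle 0|^{\otimes a}\otimes\mathbb 1)|\Phi\rangle=0$. (2) There is an absolute constant $K>0$ such that for all $n,a\ge 0$, all $\gamma>0$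 and all $\delta\in(0,1)$ there is a quantum circuit on $b+a+n$ qubits, for some number $b$ of work qubits, that consists of fixed unitary gates and of at most $$K\cdot\frac1{\sqrt\gamma}\cdot\max\Big(1,\log\frac1\delta\Big)$$ copies of a black-box unitary $C$ or of $C^\dagger$ acting on the control and system qubits, and that has the following property. For every $c:\{0,1\}^n\to[0,1]$ with $\gamma(c)=\gamma$ and every exact block-encoding $C$ of $H_c$ with $a$ control qubits, if the circuit is run with this $C$ from the all-zero state of all its qubits and the work and control qubits are then measured, the outcome is all-zero with probability at least $1-\delta$, and on this outcome the system qubits are left exactly in the state $|\psi_c\rangle$. (The circuit, apart from the black box, may depend on $n,a,\gamma,\delta$ but not on $c$ or $C$.) -/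

import Mathlib

open scoped Matrix Kronecker

noncomputable section

namespace StatePrep

/-- Computational basis labels of a register of `n` qubits; the label `0` is the string
`0…0`. -/
abbrev Bits (n : ℕ) : Type := Fin n → Fin 2

/-- State vectors with basis labels `ι`, given by their amplitudes. -/
abbrev Ket (ι : Type) : Type := ι → ℂ

/-- Tensor product of state vectors. -/
def tensor {ι κ : Type} (u : Ket ι) (v : Ket κ) : Ket (ι × κ) := fun p => u p.1 * v p.2

/-- The `n`-fold tensor power of a one-qubit state vector. -/
def tensorPow (v : Ket (Fin 2)) (n : ℕ) : Ket (Bits n) := fun x => ∏ i, v (x i)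

/-- The all-zero state `|0⟩^{⊗n}`. -/
def ketZero (n : ℕ) : Ket (Bits n) := tensorPow ![1, 0] n

/-- The state `|+⟩^{⊗n}`, where `|+⟩ = (|0⟩ + |1⟩)/√2`. -/
def ketPlus (n : ℕ) : Ket (Bits n) := tensorPow (fun _ => ((1 / √2 : ℝ) : ℂ)) n

/-- The matrix `H_c = diag(c(x)/2)`. -/
def Hc {n : ℕ} (c : Bits n → ℝ) : Matrix (Bits n) (Bits n) ℂ :=
  Matrix.diagonal fun x => ((c x / 2 : ℝ) : ℂ)

/-- The average `γ = (1/N) ∑ₓ c(x)²` with `N = 2ⁿ`. -/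
def gamma {n : ℕ} (c : Bits n → ℝ) : ℝ := (1 / (2 : ℝ) ^ n) * ∑ x, c x ^ 2

/-- The target state `|ψ_c⟩ = (1/√(N γ)) ∑ₓ c(x) |x⟩`. -/
def psi {n : ℕ} (c : Bits n → ℝ) : Ket (Bits n) :=
  fun x => ((1 / √((2 : ℝ) ^ n * gamma c) * c x : ℝ) : ℂ)

/-- The block `(⟨0|^{⊗a} ⊗ 1) U (|0⟩^{⊗a} ⊗ 1)`. -/
def zeroBlock {a n : ℕ} (U : Matrix (Bits a × Bits n) (Bits a × Bits n) ℂ) :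
    Matrix (Bits n) (Bits n) ℂ :=
  Matrix.of fun x y => U (0, x) (0, y)

/-- `A` is `(a, ε)`-block-encoded in the unitary `U`: in operator norm,
`‖A - (⟨0|^{⊗a} ⊗ 1) U (|0⟩^{⊗a} ⊗ 1)‖ ≤ ε`. -/
def IsBlockEncoding {a n : ℕ} (ε : ℝ) (U : Matrix.unitaryGroup (Bits a × Bits n) ℂ)
    (A : Matrix (Bits n) (Bits n) ℂ) : Prop :=
  ‖Matrix.toEuclideanCLM (n := Bits n) (𝕜 := ℂ)
    (A - zeroBlock (U : Matrix (Bits a × Bits n) (Bits a × Bits n) ℂ))‖ ≤ ε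

/-- Basis labels of the whole machine: `b` work qubits, `a` control qubits, `n` system qubits. -/
abbrev Labels (b a n : ℕ) : Type := Bits b × (Bits a × Bits n)

/-- One step of a query circuit: a fixed unitary gate, or one copy of the black-box unitary on
the control and system qubits, or one copy of its inverse. -/
inductive Step (b a n : ℕ) : Type
  | gate (V : Matrix.unitaryGroup (Labels b a n) ℂ) : Step b a n
  | query : Step b a n
  | queryInv : Step b a n

/-- The matrix of a step when the black box is `C`. -/
def Step.toMatrix {b a n : ℕ} (C : Matrix.unitaryGroup (Bits a × Bits n) ℂ) :
    Step b a n → Matrix (Labels b a n) (Labels b a n) ℂ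
  | .gate V => (V : Matrix (Labels b a n) (Labels b a n) ℂ)
  | .query => (1 : Matrix (Bits b) (Bits b) ℂ) ⊗ₖ
      (C : Matrix (Bits a × Bits n) (Bits a × Bits n) ℂ)
  | .queryInv => (1 : Matrix (Bits b) (Bits b) ℂ) ⊗ₖ
      (C : Matrix (Bits a × Bits n) (Bits a × Bits n) ℂ)ᴴ

/-- Number of copies of the black box (or of its inverse) in a step. -/
def Step.cost {b a n : ℕ} : Step b a n → ℕ
  | .gate _ => 0
  | .query => 1
  | .queryInv => 1

/-- A query circuit: a list of steps, executed from the head on. The gates are part of the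
circuit and so cannot depend on the black box. -/
abbrev QueryCircuit (b a n : ℕ) : Type := List (Step b a n)

/-- Number of copies of the black box (or of its inverse) that a circuit uses. -/
def QueryCircuit.queries {b a n : ℕ} (Q : QueryCircuit b a n) : ℕ := (Q.map Step.cost).sum

/-- The state that the circuit reaches from `|0⟩` on all of its qubits. -/
def QueryCircuit.output {b a n : ℕ} (Q : QueryCircuit b a n)
    (C : Matrix.unitaryGroup (Bits a × Bits n) ℂ) : Ket (Labels b a n) :=
  Q.foldl (fun v s => s.toMatrix C *ᵥ v)
    (tensor (ketZero b) (tensor (ketZero a) (ketZero n)))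

/-- The system component of a state at the all-zero outcome of a measurement of the work and
control qubits, `(⟨0|^{⊗b} ⊗ ⟨0|^{⊗a} ⊗ 1) v`, not normalized. -/
def postselect {b a n : ℕ} (v : Ket (Labels b a n)) : Ket (Bits n) := fun x => v (0, (0, x))

/-- Probability of the all-zero outcome when the work and control qubits are measured. -/
def successProb {b a n : ℕ} (v : Ket (Labels b a n)) : ℝ := ∑ x, ‖postselect v x‖ ^ 2

/-- With black box `C` the circuit obtains the state `ψ` with probability at least `p`: measuring
the work and control qubits of its final state gives the all-zero outcome with probability at
least `p`, and on this outcome the system is left exactly in the state `ψ`. -/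
def QueryCircuit.Obtains {b a n : ℕ} (Q : QueryCircuit b a n)
    (C : Matrix.unitaryGroup (Bits a × Bits n) ℂ) (ψ : Ket (Bits n)) (p : ℝ) : Prop :=
  p ≤ successProb (Q.output C) ∧
    postselect (Q.output C) = ((√(successProb (Q.output C)) : ℝ) : ℂ) • ψ

end StatePrep

end

open StatePrep

/-! The method is exact amplitude amplification. One query on `|0⟩|+⟩` gives the target with
amplitude `√γ/2`, which depends on `c` only through `γ`. A work qubit damps it to exactly `sin θ`,
`θ = π/(2(2k+1))`, for some `k` of order `1/√γ`. A round is the sign flip of the bad subspace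
followed by the reflection at the state `φ` after the first query, and rotates by `2θ`
(`amplification_round`). After `k` rounds the angle is `(2k+1)θ = π/2`
(`output_amplificationCircuit`), so success is certain (`exists_circuit_obtains`): the factor `max 1
(log (1/δ))` is just bounded below by `1`. The gates involve only `γ` and the dimensions, so one
circuit serves every `c` and `C`. -/

namespace StatePrep

open Matrix

/-! ### Householder reflections and the rotation they generate -/

section Reflections

variable {ι : Type} [Fintype ι] [DecidableEq ι]

/-- The reflection in the hyperplane orthogonal to `w` (the identity if `w = 0`). -/
noncomputable def reflectionMatrix (w : ι → ℂ) : Matrix ι ι ℂ :=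
  1 - (2 / (star w ⬝ᵥ w)) • vecMulVec w (star w)

theorem reflectionMatrix_mulVec (w v : ι → ℂ) :
    reflectionMatrix w *ᵥ v = v - (2 / (star w ⬝ᵥ w) * (star w ⬝ᵥ v)) • w := by
  rw [reflectionMatrix, sub_mulVec, one_mulVec, smul_mulVec, vecMulVec_mulVec]
  ext i
  simp [mul_comm, mul_left_comm]

theorem reflectionMatrix_isHermitian (w : ι → ℂ) : (reflectionMatrix w)ᴴ = reflectionMatrix w := by
  have h : star (star w ⬝ᵥ w) = star w ⬝ᵥ w := (star_dotProduct w w).symm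
  simp [reflectionMatrix, conjTranspose_sub, conjTranspose_smul, conjTranspose_vecMulVec, h]

theorem reflectionMatrix_mem_unitaryGroup (w : ι → ℂ) :
    reflectionMatrix w ∈ unitaryGroup ι ℂ := by
  rw [mem_unitaryGroup_iff, star_eq_conjTranspose, reflectionMatrix_isHermitian]
  refine Matrix.ext_of_mulVec_single fun i => ?_
  rw [← mulVec_mulVec, one_mulVec]
  generalize (Pi.single i 1 : ι → ℂ) = v
  -- For `w = 0` the coefficient is `2 / 0 = 0`, so the matrix is the identity.
  by_cases hw : star w ⬝ᵥ w = 0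
  · simp [reflectionMatrix_mulVec, hw]
  · rw [reflectionMatrix_mulVec, reflectionMatrix_mulVec, dotProduct_sub, dotProduct_smul]
    ext j
    simp only [Pi.sub_apply, Pi.smul_apply, smul_eq_mul]
    field_simp
    ring

/-- A basis state is carried to any unit vector with a real amplitude there by a unitary. -/
theorem exists_unitary_mulVec_single (i : ι) (u : ι → ℂ) (hu : star u ⬝ᵥ u = 1)
    (hi : star (u i) = u i) :
    ∃ V : unitaryGroup ι ℂ, (V : Matrix ι ι ℂ) *ᵥ Pi.single i 1 = u := by
  -- The reflection along the difference of two unit vectors swaps them exactly when their inner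
  -- product is real, hence the condition on `u i`.
  refine ⟨⟨_, reflectionMatrix_mem_unitaryGroup (Pi.single i 1 - u)⟩, ?_⟩
  have h1 : star (Pi.single i 1 - u) ⬝ᵥ Pi.single i 1 = 1 - u i := by
    rw [dotProduct_single, Pi.star_apply, Pi.sub_apply, star_sub, hi]; simp
  have h2 : star (Pi.single i 1 - u) ⬝ᵥ (Pi.single i 1 - u) = 2 * (1 - u i) := by
    have h3 : star (Pi.single i 1 - u) ⬝ᵥ u = u i - 1 := by
      rw [star_sub, sub_dotProduct, hu, ← Pi.single_star]; simp
    rw [dotProduct_sub, h1, h3]; ring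
  show reflectionMatrix _ *ᵥ _ = _
  rw [reflectionMatrix_mulVec, h1, h2]
  by_cases h0 : 1 - u i = 0
  · have hw : Pi.single i 1 - u = 0 := by
      open scoped ComplexOrder in
      exact dotProduct_star_self_eq_zero.1 (by rw [h2, h0, mul_zero])
    simp [sub_eq_zero.1 hw]
  · have : 2 / (2 * (1 - u i)) * (1 - u i) = 1 := by field_simp
    rw [this, one_smul, sub_sub_cancel]

omit [DecidableEq ι] in
/-- One round of amplitude amplification is a rotation by `2θ` in the plane of `g` and `h`. -/
theorem amplification_round (φ g h : ι → ℂ) (θ t : ℝ)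
    (hφ : φ = (Real.sin θ : ℂ) • g + (Real.cos θ : ℂ) • h)
    (hg : star φ ⬝ᵥ g = (Real.sin θ : ℂ)) (hh : star φ ⬝ᵥ h = (Real.cos θ : ℂ)) :
    ((Real.sin t : ℂ) • g - (Real.cos t : ℂ) • h) -
        (2 * (star φ ⬝ᵥ ((Real.sin t : ℂ) • g - (Real.cos t : ℂ) • h))) • φ =
      (Real.sin (t + 2 * θ) : ℂ) • g + (Real.cos (t + 2 * θ) : ℂ) • h := by
  -- Only the inner products with `φ` enter; the rest is trigonometry.
  rw [dotProduct_sub, dotProduct_smul, dotProduct_smul, hg, hh, hφ]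
  have hc : Real.sin θ ^ 2 + Real.cos θ ^ 2 = 1 := Real.sin_sq_add_cos_sq θ
  have h1 : Real.sin (t + 2 * θ) =
      Real.sin t - 2 * (Real.sin t * Real.sin θ - Real.cos t * Real.cos θ) * Real.sin θ := by
    rw [Real.sin_add, Real.cos_two_mul, Real.sin_two_mul]
    linear_combination (2 * Real.sin t) * hc
  have h2 : Real.cos (t + 2 * θ) =
      -Real.cos t - 2 * (Real.sin t * Real.sin θ - Real.cos t * Real.cos θ) * Real.cos θ := by
    rw [Real.cos_add, Real.cos_two_mul, Real.sin_two_mul]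
    ring
  rw [h1, h2]
  ext i
  simp only [Pi.sub_apply, Pi.add_apply, Pi.smul_apply, smul_eq_mul]
  push_cast
  ring

end Reflections

/-! ### Product states and the block-encoded amplitude -/

section States

theorem ketZero_eq_single (n : ℕ) : ketZero n = Pi.single 0 1 := by
  ext x
  rw [ketZero, tensorPow, Pi.single_apply]
  split_ifs with h
  · simp [h]
  · obtain ⟨i, hi⟩ := Function.ne_iff.1 h
    refine Finset.prod_eq_zero (Finset.mem_univ i) ?_
    have : x i = 1 := by
      have : x i ≠ 0 := hi
      omega
    simp [this]

theorem tensor_single {ι κ : Type} [DecidableEq ι] [DecidableEq κ] (i : ι) (j : κ) :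
    tensor (Pi.single i 1) (Pi.single j 1) = Pi.single (i, j) (1 : ℂ) := by
  ext ⟨x, y⟩
  simp only [tensor, Pi.single_apply, Prod.mk.injEq]
  split_ifs <;> simp_all

theorem star_tensor_dotProduct {ι κ : Type} [Fintype ι] [Fintype κ] (u u' : Ket ι) (v v' : Ket κ) :
    star (tensor u v) ⬝ᵥ tensor u' v' = (star u ⬝ᵥ u') * (star v ⬝ᵥ v') := by
  simp only [dotProduct, tensor, Fintype.sum_prod_type, Finset.sum_mul_sum, Pi.star_apply, star_mul]
  refine Finset.sum_congr rfl fun _ _ => Finset.sum_congr rfl fun _ _ => ?_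
  ring

theorem one_kronecker_mulVec_tensor {ι κ : Type} [Fintype ι] [DecidableEq ι] [Fintype κ]
    (M : Matrix κ κ ℂ) (u : Ket ι) (v : Ket κ) :
    ((1 : Matrix ι ι ℂ) ⊗ₖ M) *ᵥ tensor u v = tensor u (M *ᵥ v) := by
  ext ⟨x, y⟩
  simp only [mulVec, dotProduct, tensor, Fintype.sum_prod_type, kroneckerMap_apply, one_apply]
  rw [Finset.sum_eq_single x]
  · simp only [if_true, one_mul, Finset.mul_sum]
    exact Finset.sum_congr rfl fun _ _ => by ring
  · intro z _ hz
    simp [Ne.symm hz]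
  · simp

theorem ketPlus_apply (n : ℕ) (x : Bits n) : ketPlus n x = ((1 / √2 ^ n : ℝ) : ℂ) := by
  simp [ketPlus, tensorPow]

theorem star_ketPlus_dotProduct_self (n : ℕ) : star (ketPlus n) ⬝ᵥ ketPlus n = 1 := by
  have h : (1 / √2 ^ n : ℝ) * (1 / √2 ^ n) = (1 / 2 ^ n : ℝ) := by
    rw [div_mul_div_comm, ← mul_pow, Real.mul_self_sqrt (by norm_num), one_mul]
  simp only [dotProduct, Pi.star_apply, ketPlus_apply, Complex.star_def, Complex.conj_ofReal,
    ← Complex.ofReal_mul, h]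
  simp

theorem Hc_mulVec_ketPlus {n : ℕ} (c : Bits n → ℝ) :
    Hc c *ᵥ ketPlus n = ((√(gamma c) / 2 : ℝ) : ℂ) • psi c := by
  ext x
  rw [Hc, mulVec_diagonal, ketPlus_apply, Pi.smul_apply, psi, smul_eq_mul, ← Complex.ofReal_mul,
    ← Complex.ofReal_mul]
  congr 1
  have hs : (√2 : ℝ) ^ n = √(2 ^ n) := by
    rw [Real.sqrt_eq_rpow, Real.sqrt_eq_rpow, ← Real.rpow_natCast, ← Real.rpow_mul (by norm_num),
      mul_comm, Real.rpow_mul (by norm_num), Real.rpow_natCast]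
  have h0 : 0 ≤ gamma c := mul_nonneg (by positivity) (Finset.sum_nonneg fun _ _ => sq_nonneg _)
  rw [hs, Real.sqrt_mul (by positivity)]
  -- If `γ = 0`, every `c x` vanishes and both sides are zero.
  rcases h0.eq_or_lt with h | h
  · have : ∑ x, c x ^ 2 = 0 := by
      have := h.symm
      rw [gamma] at this
      exact (mul_eq_zero.1 this).resolve_left (by positivity)
    have hx := (Finset.sum_eq_zero_iff_of_nonneg fun _ _ => sq_nonneg _).1 this x
      (Finset.mem_univ x)
    simp [pow_eq_zero_iff two_ne_zero |>.1 hx]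
  · have := Real.sqrt_pos.2 h
    have : 0 < √((2 : ℝ) ^ n) := by positivity
    field_simp

theorem star_psi_dotProduct_self {n : ℕ} (c : Bits n → ℝ) (h : 0 < gamma c) :
    star (psi c) ⬝ᵥ psi c = 1 := by
  have hs : ∑ x, c x ^ 2 = 2 ^ n * gamma c := by
    rw [gamma]; field_simp
  simp only [dotProduct, Pi.star_apply, psi, Complex.star_def, Complex.conj_ofReal,
    ← Complex.ofReal_mul, ← Complex.ofReal_sum]
  have : ∀ x, 1 / √((2 : ℝ) ^ n * gamma c) * c x * (1 / √((2 : ℝ) ^ n * gamma c) * c x) =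
      1 / (2 ^ n * gamma c) * c x ^ 2 := fun x => by
    have h1 : √((2 : ℝ) ^ n * gamma c) * √((2 : ℝ) ^ n * gamma c) = 2 ^ n * gamma c :=
      Real.mul_self_sqrt (by positivity)
    rw [div_mul_eq_mul_div, one_mul, div_mul_div_comm, h1, ← sq, div_mul_eq_mul_div, one_mul]
  simp only [this, ← Finset.mul_sum, hs]
  rw [one_div, inv_mul_cancel₀ (by positivity), Complex.ofReal_one]

theorem gamma_le_one {n : ℕ} (c : Bits n → ℝ) (hc : ∀ x, c x ∈ Set.Icc (0 : ℝ) 1) :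
    gamma c ≤ 1 := by
  have h : ∑ x, c x ^ 2 ≤ 2 ^ n := by
    refine (Finset.sum_le_sum fun x _ => pow_le_one₀ (n := 2) (hc x).1 (hc x).2).trans ?_
    simp
  rw [gamma, one_div, inv_mul_le_iff₀ (by positivity), mul_one]
  exact h

theorem zeroBlock_eq_of_isBlockEncoding_zero {a n : ℕ} {C : unitaryGroup (Bits a × Bits n) ℂ}
    {A : Matrix (Bits n) (Bits n) ℂ} (h : IsBlockEncoding 0 C A) :
    zeroBlock (C : Matrix (Bits a × Bits n) (Bits a × Bits n) ℂ) = A := by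
  have h0 := norm_le_zero_iff.1 h
  exact (sub_eq_zero.1 ((toEuclideanCLM (n := Bits n) (𝕜 := ℂ)).injective
    (h0.trans (map_zero _).symm))).symm

theorem mulVec_tensor_ketZero_apply {a n : ℕ} (U : Matrix (Bits a × Bits n) (Bits a × Bits n) ℂ)
    (v : Ket (Bits n)) (x : Bits n) :
    (U *ᵥ tensor (ketZero a) v) (0, x) = (zeroBlock U *ᵥ v) x := by
  simp only [mulVec, dotProduct, tensor, Fintype.sum_prod_type, ketZero_eq_single, zeroBlock,
    of_apply]
  rw [Finset.sum_eq_single 0]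
  · simp
  · intro y _ hy
    simp [hy]
  · simp

theorem blockEncoding_mulVec_apply {a n : ℕ} {C : unitaryGroup (Bits a × Bits n) ℂ}
    {c : Bits n → ℝ} (h : IsBlockEncoding 0 C (Hc c)) (x : Bits n) :
    ((C : Matrix (Bits a × Bits n) (Bits a × Bits n) ℂ) *ᵥ tensor (ketZero a) (ketPlus n)) (0, x) =
      ((√(gamma c) / 2 : ℝ) : ℂ) * psi c x := by
  rw [mulVec_tensor_ketZero_apply, zeroBlock_eq_of_isBlockEncoding_zero h, Hc_mulVec_ketPlus]
  rfl

end States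

/-! ### The amplification circuit and its output -/

section Circuit

variable {b a n : ℕ}

/-- The sign flip of the basis states on which the work and control qubits are not all zero. -/
noncomputable def signMatrix (b a n : ℕ) : Matrix (Labels b a n) (Labels b a n) ℂ :=
  diagonal fun p => if p.1 = 0 ∧ p.2.1 = 0 then 1 else -1

theorem signMatrix_mem_unitaryGroup (b a n : ℕ) :
    signMatrix b a n ∈ unitaryGroup (Labels b a n) ℂ := by
  rw [mem_unitaryGroup_iff, star_eq_conjTranspose, signMatrix, diagonal_conjTranspose,
    diagonal_mul_diagonal, ← diagonal_one]
  congr 1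
  ext p
  simp only [Pi.star_apply]
  split_ifs <;> simp

/-- One round of amplitude amplification with start state `u` of the black box. -/
noncomputable def amplificationRound (u : Ket (Labels b a n)) : QueryCircuit b a n :=
  [.gate ⟨_, signMatrix_mem_unitaryGroup b a n⟩, .queryInv,
    .gate ⟨_, reflectionMatrix_mem_unitaryGroup u⟩, .query]

/-- State preparation by `V`, one query, and `k` rounds of amplitude amplification. -/
noncomputable def amplificationCircuit (V : unitaryGroup (Labels b a n) ℂ) (u : Ket (Labels b a n)) :
    ℕ → QueryCircuit b a n
  | 0 => [.gate V, .query]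
  | k + 1 => amplificationCircuit V u k ++ amplificationRound u

theorem queries_amplificationCircuit (V : unitaryGroup (Labels b a n) ℂ) (u : Ket (Labels b a n))
    (k : ℕ) : (amplificationCircuit V u k).queries = 2 * k + 1 := by
  induction k with
  | zero => simp [amplificationCircuit, QueryCircuit.queries, Step.cost]
  | succ k ih =>
    have : (amplificationCircuit V u (k + 1)).queries =
        (amplificationCircuit V u k).queries + 2 := by
      simp [amplificationCircuit, amplificationRound, QueryCircuit.queries, Step.cost]
    omega

/-- The black box on the whole machine. -/
noncomputable def fullQuery (b : ℕ) (C : unitaryGroup (Bits a × Bits n) ℂ) :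
    Matrix (Labels b a n) (Labels b a n) ℂ :=
  (1 : Matrix (Bits b) (Bits b) ℂ) ⊗ₖ (C : Matrix (Bits a × Bits n) (Bits a × Bits n) ℂ)

theorem conjTranspose_fullQuery (b : ℕ) (C : unitaryGroup (Bits a × Bits n) ℂ) :
    (fullQuery b C)ᴴ = (1 : Matrix (Bits b) (Bits b) ℂ) ⊗ₖ
      (C : Matrix (Bits a × Bits n) (Bits a × Bits n) ℂ)ᴴ := by
  rw [fullQuery, conjTranspose_kronecker, conjTranspose_one]

theorem fullQuery_mul_conjTranspose (b : ℕ) (C : unitaryGroup (Bits a × Bits n) ℂ) :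
    fullQuery b C * (fullQuery b C)ᴴ = 1 := by
  rw [conjTranspose_fullQuery, fullQuery, ← mul_kronecker_mul, ← star_eq_conjTranspose,
    mem_unitaryGroup_iff.1 C.2, one_mul, one_kronecker_one]

theorem conjTranspose_mul_fullQuery (b : ℕ) (C : unitaryGroup (Bits a × Bits n) ℂ) :
    (fullQuery b C)ᴴ * fullQuery b C = 1 :=
  mul_eq_one_comm.1 (fullQuery_mul_conjTranspose b C)

/-- Conjugating the known reflection at `u` by the query gives the reflection at the unknown state
`fullQuery b C *ᵥ u`, so two queries suffice. -/
theorem foldl_amplificationRound (C : unitaryGroup (Bits a × Bits n) ℂ) (u v : Ket (Labels b a n))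
    (hu : star u ⬝ᵥ u = 1) :
    (amplificationRound u).foldl (fun v s => s.toMatrix C *ᵥ v) v =
      signMatrix b a n *ᵥ v -
        (2 * (star (fullQuery b C *ᵥ u) ⬝ᵥ (signMatrix b a n *ᵥ v))) • (fullQuery b C *ᵥ u) := by
  have h : (amplificationRound u).foldl (fun v s => s.toMatrix C *ᵥ v) v =
      fullQuery b C *ᵥ (reflectionMatrix u *ᵥ ((fullQuery b C)ᴴ *ᵥ (signMatrix b a n *ᵥ v))) := by
    rw [conjTranspose_fullQuery]
    rfl
  rw [h, reflectionMatrix_mulVec, mulVec_sub, mulVec_smul, mulVec_mulVec (M := fullQuery b C),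
    fullQuery_mul_conjTranspose, one_mulVec, hu, div_one, star_mulVec, dotProduct_mulVec]

/-- The first query produces angle `θ`; each round negates the `h` component and then reflects at
the start state, adding `2θ`. -/
theorem output_amplificationCircuit (C : unitaryGroup (Bits a × Bits n) ℂ)
    (V : unitaryGroup (Labels b a n) ℂ) (u g h : Ket (Labels b a n)) (θ : ℝ)
    (hV : (V : Matrix (Labels b a n) (Labels b a n) ℂ) *ᵥ Pi.single 0 1 = u)
    (hu : star u ⬝ᵥ u = 1)
    (hφ : fullQuery b C *ᵥ u = (Real.sin θ : ℂ) • g + (Real.cos θ : ℂ) • h)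
    (hg : star (fullQuery b C *ᵥ u) ⬝ᵥ g = (Real.sin θ : ℂ))
    (hh : star (fullQuery b C *ᵥ u) ⬝ᵥ h = (Real.cos θ : ℂ))
    (hSg : signMatrix b a n *ᵥ g = g) (hSh : signMatrix b a n *ᵥ h = -h) (k : ℕ) :
    (amplificationCircuit V u k).output C =
      (Real.sin ((2 * k + 1) * θ) : ℂ) • g + (Real.cos ((2 * k + 1) * θ) : ℂ) • h := by
  induction k with
  | zero =>
    have : (amplificationCircuit V u 0).output C = fullQuery b C *ᵥ u := by
      rw [← hV, ← Prod.mk_zero_zero, ← Prod.mk_zero_zero, ← tensor_single, ← tensor_single,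
        ← ketZero_eq_single, ← ketZero_eq_single, ← ketZero_eq_single]
      rfl
    rw [this, hφ]
    simp
  | succ k ih =>
    have : (amplificationCircuit V u (k + 1)).output C =
        (amplificationRound u).foldl (fun v s => s.toMatrix C *ᵥ v)
          ((amplificationCircuit V u k).output C) := List.foldl_append
    have hs : signMatrix b a n *ᵥ ((amplificationCircuit V u k).output C) =
        (Real.sin ((2 * k + 1) * θ) : ℂ) • g - (Real.cos ((2 * k + 1) * θ) : ℂ) • h := by
      rw [ih, mulVec_add, mulVec_smul, mulVec_smul, hSg, hSh, smul_neg, sub_eq_add_neg]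
    rw [this, foldl_amplificationRound C u _ hu, hs, amplification_round _ g h θ _ hφ hg hh]
    have : (2 * ((k : ℝ) + 1) + 1) * θ = (2 * k + 1) * θ + 2 * θ := by ring
    rw [Nat.cast_succ, this]

/-- A one-qubit state whose amplitude at `0` is `r`. -/
noncomputable def workState (r : ℝ) : Ket (Bits 1) := fun x => if x 0 = 0 then (r : ℂ) else (√(1 - r ^ 2) : ℝ)

theorem star_workState_dotProduct_self {r : ℝ} (hr : r ^ 2 ≤ 1) :
    star (workState r) ⬝ᵥ workState r = 1 := by
  have h : √(1 - r ^ 2) * √(1 - r ^ 2) = 1 - r ^ 2 := Real.mul_self_sqrt (by linarith)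
  rw [dotProduct, ← (Equiv.funUnique (Fin 1) (Fin 2)).symm.sum_comp]
  simp only [Fin.sum_univ_two, workState, Pi.star_apply, Equiv.funUnique_symm_apply,
    uniqueElim_const, if_true, one_ne_zero, if_false, Complex.star_def, Complex.conj_ofReal,
    ← Complex.ofReal_mul, ← Complex.ofReal_add, h]
  norm_num
  norm_cast
  ring

/-- Exact amplitude amplification: if the success amplitude `√γ / 2` is at least
`sin (π / (2 (2 k + 1)))`, then `k` rounds prepare the target state with certainty. -/
theorem exists_circuit_obtains (n a k : ℕ) (hk : k ≠ 0) (γ : ℝ) (hγ : 0 < γ)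
    (hs : Real.sin (Real.pi / (2 * (2 * k + 1))) ≤ √γ / 2) :
    ∃ Q : QueryCircuit 1 a n, Q.queries = 2 * k + 1 ∧
      ∀ c : Bits n → ℝ, gamma c = γ →
        ∀ C : unitaryGroup (Bits a × Bits n) ℂ, IsBlockEncoding 0 C (Hc c) →
          Q.Obtains C (psi c) 1 := by
  set θ : ℝ := Real.pi / (2 * (2 * k + 1)) with hθ
  have hk1 : (1 : ℝ) ≤ k := by exact_mod_cast Nat.one_le_iff_ne_zero.2 hk
  have hθ0 : 0 < θ := by positivity
  -- Here `k ≠ 0` matters: it keeps `cos θ` nonzero, so that `h` below can be defined by dividing by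
  -- it.
  have hθ1 : θ < Real.pi / 2 := by
    rw [hθ]
    exact div_lt_div_of_pos_left Real.pi_pos (by norm_num) (by linarith)
  have hcos : 0 < Real.cos θ := Real.cos_pos_of_mem_Ioo ⟨by linarith [Real.pi_pos], hθ1⟩
  have hsin : 0 < Real.sin θ := Real.sin_pos_of_pos_of_lt_pi hθ0 (by linarith)
  have hγs : 0 < √γ := Real.sqrt_pos.2 hγ
  -- The work-qubit amplitude that damps `√γ / 2` to exactly `sin θ`; it is at most `1` by `hs`.
  set r : ℝ := Real.sin θ / (√γ / 2) with hr
  have hr0 : 0 ≤ r := by positivity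
  have hr1 : r ≤ 1 := (div_le_one (by positivity)).2 hs
  have hrs : r * (√γ / 2) = Real.sin θ := div_mul_cancel₀ _ (by positivity)
  set u : Ket (Labels 1 a n) := tensor (workState r) (tensor (ketZero a) (ketPlus n)) with hu_def
  have hu : star u ⬝ᵥ u = 1 := by
    rw [hu_def, star_tensor_dotProduct, star_tensor_dotProduct, star_ketPlus_dotProduct_self,
      star_workState_dotProduct_self (pow_le_one₀ hr0 hr1), ketZero_eq_single]
    simp
  obtain ⟨V, hV⟩ := exists_unitary_mulVec_single (0 : Labels 1 a n) u hu (by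
    simp [hu_def, tensor, workState, ketZero_eq_single, ketPlus_apply])
  refine ⟨amplificationCircuit V u k, queries_amplificationCircuit V u k, ?_⟩
  intro c hc C hC
  set g : Ket (Labels 1 a n) := tensor (Pi.single 0 1) (tensor (Pi.single 0 1) (psi c)) with hg_def
  set φ : Ket (Labels 1 a n) := fullQuery 1 C *ᵥ u with hφ_def
  have hφ0 : ∀ x, φ (0, (0, x)) = (Real.sin θ : ℂ) * psi c x := fun x => by
    have : φ (0, (0, x)) = (r : ℂ) * (((√γ / 2 : ℝ) : ℂ) * psi c x) := by
      rw [hφ_def, hu_def, fullQuery, one_kronecker_mulVec_tensor, tensor,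
        blockEncoding_mulVec_apply hC, hc]
      simp [workState]
    rw [this, ← mul_assoc, ← Complex.ofReal_mul, hrs]
  have hg0 : ∀ x, g (0, (0, x)) = psi c x := fun x => by simp [hg_def, tensor]
  have hg1 : ∀ p : Labels 1 a n, ¬(p.1 = 0 ∧ p.2.1 = 0) → g p = 0 := fun p hp => by
    simp only [hg_def, tensor, Pi.single_apply]
    by_cases h1 : p.1 = 0
    · simp [show p.2.1 ≠ 0 from fun h2 => hp ⟨h1, h2⟩]
    · simp [h1]
  have hψ : star (psi c) ⬝ᵥ psi c = 1 := star_psi_dotProduct_self c (hc ▸ hγ)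
  have hφφ : star φ ⬝ᵥ φ = 1 := by
    rw [hφ_def, star_mulVec, ← dotProduct_mulVec, mulVec_mulVec, conjTranspose_mul_fullQuery,
      one_mulVec, hu]
  have hφg : star φ ⬝ᵥ g = (Real.sin θ : ℂ) := by
    have h1 : star φ ⬝ᵥ g = ∑ x, star (φ (0, (0, x))) * psi c x := by
      simp only [dotProduct, Pi.star_apply, Fintype.sum_prod_type]
      rw [Finset.sum_eq_single 0, Finset.sum_eq_single 0]
      · simp only [hg0]
      · exact fun y _ hy => Finset.sum_eq_zero fun x _ => by rw [hg1 _ (by simp [hy]), mul_zero]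
      · simp
      · exact fun z _ hz => Finset.sum_eq_zero fun y _ => Finset.sum_eq_zero fun x _ => by
          rw [hg1 _ (by simp [hz]), mul_zero]
      · simp
    rw [h1]
    simp only [hφ0, star_mul, Complex.star_def, Complex.conj_ofReal]
    calc _ = (Real.sin θ : ℂ) * (star (psi c) ⬝ᵥ psi c) := by
          rw [dotProduct, Finset.mul_sum]
          exact Finset.sum_congr rfl fun x _ => by
            rw [Pi.star_apply, Complex.star_def]; ring
      _ = _ := by rw [hψ, mul_one]
  have hcosC : (Real.cos θ : ℂ) ≠ 0 := Complex.ofReal_ne_zero.2 hcos.ne'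
  -- The normalized bad component of `φ`: it vanishes where work and control qubits are all zero.
  set h : Ket (Labels 1 a n) := (Real.cos θ : ℂ)⁻¹ • (φ - (Real.sin θ : ℂ) • g) with hh_def
  have hφ : φ = (Real.sin θ : ℂ) • g + (Real.cos θ : ℂ) • h := by
    rw [hh_def, smul_inv_smul₀ hcosC]
    abel
  have hφh : star φ ⬝ᵥ h = (Real.cos θ : ℂ) := by
    rw [hh_def, dotProduct_smul, dotProduct_sub, dotProduct_smul, hφφ, hφg, smul_eq_mul,
      smul_eq_mul, inv_mul_eq_iff_eq_mul₀ hcosC]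
    have : 1 - Real.sin θ * Real.sin θ = Real.cos θ * Real.cos θ := by
      linear_combination -Real.sin_sq_add_cos_sq θ
    exact_mod_cast this
  have hSg : signMatrix 1 a n *ᵥ g = g := by
    ext p
    rw [signMatrix, mulVec_diagonal]
    split_ifs with hp
    · rw [one_mul]
    · rw [hg1 p hp, mul_zero]
  have hSh : signMatrix 1 a n *ᵥ h = -h := by
    ext p
    rw [signMatrix, mulVec_diagonal, Pi.neg_apply]
    split_ifs with hp
    · obtain ⟨y, z, x⟩ := p
      obtain ⟨rfl, rfl⟩ : y = 0 ∧ z = 0 := hp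
      simp [hh_def, hφ0, hg0]
    · rw [neg_one_mul]
  have hout : (amplificationCircuit V u k).output C = g := by
    rw [output_amplificationCircuit C V u g h θ hV hu hφ hφg hφh hSg hSh]
    have : (2 * (k : ℝ) + 1) * θ = Real.pi / 2 := by
      rw [hθ]
      field_simp
    rw [this, Real.sin_pi_div_two, Real.cos_pi_div_two]
    simp
  have hpost : postselect ((amplificationCircuit V u k).output C) = psi c := by
    rw [hout]
    exact funext hg0
  have hprob : successProb ((amplificationCircuit V u k).output C) = 1 := by
    rw [successProb, hpost]
    have : ((∑ x, ‖psi c x‖ ^ 2 : ℝ) : ℂ) = 1 := by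
      rw [← hψ, dotProduct]
      push_cast
      exact Finset.sum_congr rfl fun x _ => (Complex.conj_mul' _).symm
    exact_mod_cast this
  refine ⟨hprob.ge, ?_⟩
  rw [hpost, hprob]
  simp

end Circuit

end StatePrep

theorem mainTheorem3 :
    -- `H_c |+⟩ = (√γ/2) |ψ_c⟩`, and `C |0⟩|+⟩ = (√γ/2) |0⟩|ψ_c⟩ + |Φ⟩` with `⟨0|Φ⟩ = 0`
    (∀ (n : ℕ) (c : Bits n → ℝ), (∀ x, c x ∈ Set.Icc (0 : ℝ) 1) →
      Hc c *ᵥ ketPlus n = ((√(gamma c) / 2 : ℝ) : ℂ) • psi c ∧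
      ∀ (a : ℕ) (C : Matrix.unitaryGroup (Bits a × Bits n) ℂ), IsBlockEncoding 0 C (Hc c) →
        ∃ Φ : Ket (Bits a × Bits n), (∀ x, Φ (0, x) = 0) ∧
          (C : Matrix (Bits a × Bits n) (Bits a × Bits n) ℂ) *ᵥ tensor (ketZero a) (ketPlus n) =
            ((√(gamma c) / 2 : ℝ) : ℂ) • tensor (ketZero a) (psi c) + Φ) ∧
    -- one circuit for all `c` with the given average `γ` and all exact block-encodings of `H_c`
    (∃ K : ℝ, 0 < K ∧ ∀ (n a : ℕ) (γ δ : ℝ), 0 < γ → 0 < δ → δ < 1 →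
      ∃ (b : ℕ) (Q : QueryCircuit b a n),
        (Q.queries : ℝ) ≤ K * (1 / √γ * max 1 (Real.log (1 / δ))) ∧
        ∀ c : Bits n → ℝ, (∀ x, c x ∈ Set.Icc (0 : ℝ) 1) → gamma c = γ →
          ∀ C : Matrix.unitaryGroup (Bits a × Bits n) ℂ, IsBlockEncoding 0 C (Hc c) →
            Q.Obtains C (psi c) (1 - δ)) := by
  -- The constant: `2k + 1 < π/√γ + 3 ≤ 7/√γ`, by `π ≤ 4` and `√γ ≤ 1`.
  refine ⟨fun n c hc => ⟨Hc_mulVec_ketPlus c, fun a C hC => ?_⟩, 7, by norm_num, ?_⟩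
  · refine ⟨C *ᵥ tensor (ketZero a) (ketPlus n) -
      ((√(gamma c) / 2 : ℝ) : ℂ) • tensor (ketZero a) (psi c), fun x => ?_, by abel⟩
    rw [Pi.sub_apply, blockEncoding_mulVec_apply hC]
    simp [tensor, ketZero_eq_single]
  · intro n a γ δ hγ hδ _
    have hγs : 0 < √γ := Real.sqrt_pos.2 hγ
    by_cases hγ1 : γ ≤ 1
    · have hs1 : √γ ≤ 1 := Real.sqrt_le_one.2 hγ1
      -- Then `π ≤ 2k√γ`, so `sin θ ≤ θ = π/(2(2k+1)) ≤ √γ/2`.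
      set k := ⌈Real.pi / (2 * √γ)⌉₊ with hk_def
      have hk0 : 0 < k := Nat.ceil_pos.2 (by positivity)
      have hk1 : Real.pi / (2 * √γ) ≤ k := Nat.le_ceil _
      have hk2 : (k : ℝ) < Real.pi / (2 * √γ) + 1 := Nat.ceil_lt_add_one (by positivity)
      obtain ⟨Q, hQ, hQC⟩ := exists_circuit_obtains n a k hk0.ne' γ hγ (by
        refine (Real.sin_le (by positivity)).trans ?_
        rw [div_le_iff₀ (by positivity)] at hk1 ⊢
        nlinarith)
      refine ⟨1, Q, ?_, fun c _ hcγ C hC => ?_⟩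
      · have h1 : 1 ≤ 1 / √γ := (one_le_div hγs).2 hs1
        have h2 : Real.pi / (2 * √γ) = Real.pi / 2 * (1 / √γ) := by ring
        have h3 : Real.pi / 2 * (1 / √γ) ≤ 2 * (1 / √γ) :=
          mul_le_mul_of_nonneg_right (by linarith [Real.pi_le_four]) (by positivity)
        have h4 : 1 / √γ ≤ 1 / √γ * max 1 (Real.log (1 / δ)) :=
          le_mul_of_one_le_right (by positivity) (le_max_left _ _)
        rw [hQ]
        push_cast
        linarith
      · exact ⟨(by linarith : 1 - δ ≤ 1).trans (hQC c hcγ C hC).1, (hQC c hcγ C hC).2⟩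
    -- No admissible `c` has `γ > 1`, so the empty circuit works vacuously.
    · refine ⟨0, [], ?_, fun c hc hcγ => absurd (hcγ ▸ gamma_le_one c hc) hγ1⟩
      simp only [QueryCircuit.queries, List.map_nil, List.sum_nil, Nat.cast_zero]
      positivity
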